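/- **Conventions.** For an ordered abelian group $G$, $v_GG$ is the set of archimedean classes $[g]$ of nonzero $g\in G$, ordered by $[g]<[g']$ iff $|g|>n|g'|$ for all $n\in\mathbb N$; write $v_Gg=[g]$. For an order preserving self-map $\varphi$ of a linearly ordered set $S$, $a\sim_\varphi b$ means that the convex hulls of $\{\varphi^n(a): n\ge 0\}$ and $\{\varphi^n(b): n\ge 0\}$ meet; the quotient $S/{\sim_\varphi}$ is linearly ordered by $[a]_\varphi<[b]_\varphi$ iff $a'<b'$ for all $a'\in[a]_\varphi$, $b'\in[b]_\varphi$. Let $K=\mathbb R((G))$ with its natural ordering (sign of the coefficient at the minimum of the support), and let $v$ be its natural valuation (minimum of the support), with value group $vK=G$, valuation ring $R_v$ and valuation ideal $I_v$. For a valuation ring $R_w\supseteq R_v$ with valuation ideal $I_w$, let $\mathcal U_w^{>0}$ be its group of positive units. A *strong logarithmic cross-section* for $v$ is an order preserving group embedding $h:G\to(K,+)$ with $h(G)\cap R_v=\{0\}$ and $v\,h(g)>g$ for all $g<0$. A *strong logarithm* compatible with $v$ is an embedding of ordered groups $\ell:(K^{>0},\cdot,<)\to(K,+,<)$ with $\ell(\mathcal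 U_v^{>0})=R_v\cap\operatorname{im}\ell$, $\ell(1+I_v)=I_v\cap\operatorname{im}\ell$ and $va<v\,\ell(a)$ for all $a\in K^{>0}\setminus R_v$. It *arises from* $h$ if $\ell(b)=h(-vb)$ for all $b$ in some group complement of $\mathcal U_v^{>0}$ in $K^{>0}$. It induces an order preserving map $\zeta_\ell$ on $v_GG$ by $\zeta_\ell(v_Gva)=v_Gv\ell(a)$ for $a\in K^{>0}\setminus R_v$. The *principal exponential rank* of $\ell$ is the set of all valuation rings $R_w\supsetneq R_v$ of $K$ such that $\ell(\mathcal U_w^{>0})=R_w\cap\operatorname{im}\ell$ and $\{[v_Gva]_{\zeta_\ell}: a\in\mathcal U_w^{>0}\setminus\mathcal U_v^{>0}\}\subseteq v_GG/{\sim_{\zeta_\ell}}$ has a smallest element. **Theorem.** Let $\tau$ be any order type (of a linearly ordered set, possibly empty). Then there is a divisible ordered abelian group $G$ such that $v_GG$ admits an order automorphism $\zeta$ satisfying a) $\zeta\alpha>\alpha$ for all $\alpha\in v_GG$, b) $v_GG/{\sim_\zeta}$ has order type $\tau$. Further, the power series field $\mathbb R((G))$ admits a strong logarithmic cross-section for $v$,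 from which there arises a strong logarithm, compatible with $v$, which is non-surjective if $\tau\ne\emptyset$ and whose principal exponential rank, ordered by reverse inclusion, has order type $\tau$. -/

import Mathlib

open HahnSeries

universe u

noncomputable section

namespace ExpRank

/-! ### The equivalence relation induced by a monotone self-map of a linear order -/

section PhiEquivalence

variable {S : Type u} [LinearOrder S]

/-- The forward orbit `{a, φ a, φ² a, …}`. -/
def orbit (φ : S → S) (a : S) : Set S := Set.range fun n : ℕ => φ^[n] a

/-- The order-convex hull of a subset of a linear order. -/
def convHull (s : Set S) : Set S := {x | ∃ y ∈ s, ∃ z ∈ s, y ≤ x ∧ x ≤ z}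

/-- `a ∼_φ b`: the convex hulls of the forward orbits of `a` and `b` meet. -/
def PhiRel (φ : S → S) (a b : S) : Prop :=
  (convHull (orbit φ a) ∩ convHull (orbit φ b)).Nonempty

theorem phiRel_iff {φ : S → S} {a b : S} :
    PhiRel φ a b ↔ (∃ m n, φ^[m] a ≤ φ^[n] b) ∧ (∃ m n, φ^[m] b ≤ φ^[n] a) := by
  constructor
  · rintro ⟨x, ⟨_, ⟨i, rfl⟩, _, ⟨j, rfl⟩, h1, h2⟩, ⟨_, ⟨k, rfl⟩, _, ⟨l, rfl⟩, h3, h4⟩⟩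
    exact ⟨⟨i, l, h1.trans h4⟩, ⟨k, j, h3.trans h2⟩⟩
  · rintro ⟨⟨i, l, h1⟩, ⟨k, j, h2⟩⟩
    by_contra hne
    have key : ∀ x, ¬ (x ∈ convHull (orbit φ a) ∧ x ∈ convHull (orbit φ b)) :=
      fun x hx => hne ⟨x, hx⟩
    by_cases h : φ^[k] b ≤ φ^[i] a
    · exact key (φ^[i] a) ⟨⟨_, ⟨i, rfl⟩, _, ⟨i, rfl⟩, le_rfl, le_rfl⟩,
        ⟨_, ⟨k, rfl⟩, _, ⟨l, rfl⟩, h, h1⟩⟩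
    · exact key (φ^[k] b) ⟨⟨_, ⟨i, rfl⟩, _, ⟨j, rfl⟩, (not_le.1 h).le, h2⟩,
        ⟨_, ⟨k, rfl⟩, _, ⟨k, rfl⟩, le_rfl, le_rfl⟩⟩

theorem exists_iterate_le_trans {φ : S → S} (hφ : Monotone φ) {a b c : S}
    (h1 : ∃ m n, φ^[m] a ≤ φ^[n] b) (h2 : ∃ m n, φ^[m] b ≤ φ^[n] c) :
    ∃ m n, φ^[m] a ≤ φ^[n] c := by
  obtain ⟨i, j, h1⟩ := h1
  obtain ⟨k, l, h2⟩ := h2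
  refine ⟨k + i, j + l, ?_⟩
  rw [Function.iterate_add_apply, Function.iterate_add_apply]
  refine (hφ.iterate k h1).trans ?_
  rw [← Function.iterate_add_apply, add_comm k j, Function.iterate_add_apply]
  exact hφ.iterate j h2

/-- For monotone `φ`, the relation `∼_φ` is an equivalence relation. -/
def phiSetoid (φ : S →o S) : Setoid S where
  r := PhiRel φ
  iseqv := by
    refine ⟨fun a => ?_, fun {a b} h => ?_, fun {a b c} h1 h2 => ?_⟩
    · exact phiRel_iff.2 ⟨⟨0, 0, le_rfl⟩, ⟨0, 0, le_rfl⟩⟩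
    · exact phiRel_iff.2 (phiRel_iff.1 h).symm
    · rw [phiRel_iff] at *
      exact ⟨exists_iterate_le_trans φ.monotone h1.1 h2.1,
        exists_iterate_le_trans φ.monotone h2.2 h1.2⟩

/-- The quotient `S/∼_φ`. -/
def PhiQuot (φ : S →o S) : Type u := Quotient (phiSetoid φ)

/-- The class `[a]_φ`. -/
def PhiQuot.mk (φ : S →o S) (a : S) : PhiQuot φ := Quotient.mk (phiSetoid φ) a

theorem PhiQuot.mk_eq {φ : S →o S} {a b : S} :
    PhiQuot.mk φ a = PhiQuot.mk φ b ↔ PhiRel φ a b :=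
  ⟨fun h => Quotient.exact h, fun h => Quotient.sound (s := phiSetoid φ) h⟩

theorem PhiQuot.exists_rep {φ : S →o S} (q : PhiQuot φ) : ∃ a, PhiQuot.mk φ a = q :=
  Quotient.exists_rep q

/-- `[a]_φ < [b]_φ` if and only if `a' < b'` for all `a' ∈ [a]_φ`, `b' ∈ [b]_φ`. -/
def PhiQuot.Lt {φ : S →o S} (q r : PhiQuot φ) : Prop :=
  ∀ a b, PhiQuot.mk φ a = q → PhiQuot.mk φ b = r → a < b

theorem PhiQuot.lt_of_ne {φ : S →o S} {a b : S} (hab : a < b)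
    (hne : PhiQuot.mk φ a ≠ PhiQuot.mk φ b) :
    PhiQuot.Lt (PhiQuot.mk φ a) (PhiQuot.mk φ b) := by
  intro a' b' ha hb
  by_contra hlt
  rw [not_lt] at hlt
  rw [PhiQuot.mk_eq, phiRel_iff] at ha hb
  refine hne ?_
  rw [PhiQuot.mk_eq, phiRel_iff]
  refine ⟨⟨0, 0, hab.le⟩, ?_⟩
  exact exists_iterate_le_trans φ.monotone hb.2
    (exists_iterate_le_trans φ.monotone ⟨0, 0, hlt⟩ ha.1)

/-- The linear order on `S/∼_φ` induced by the order of `S`. -/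
instance PhiQuot.instLinearOrder (φ : S →o S) : LinearOrder (PhiQuot φ) where
  le q r := q = r ∨ PhiQuot.Lt q r
  lt := PhiQuot.Lt
  le_refl q := Or.inl rfl
  le_trans := by
    rintro p q r (rfl | h1) (rfl | h2)
    · exact Or.inl rfl
    · exact Or.inr h2
    · exact Or.inr h1
    · obtain ⟨c, hc⟩ := q.exists_rep
      exact Or.inr fun a b ha hb => (h1 a c ha hc).trans (h2 c b hc hb)
  le_antisymm := by
    rintro q r (h1 | h1) (h2 | h2)
    · exact h1
    · exact h1
    · exact h2.symm
    · obtain ⟨a, ha⟩ := q.exists_rep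
      obtain ⟨b, hb⟩ := r.exists_rep
      exact absurd (h1 a b ha hb) (h2 b a hb ha).asymm
  lt_iff_le_not_ge := by
    intro q r
    obtain ⟨a, ha⟩ := q.exists_rep
    obtain ⟨b, hb⟩ := r.exists_rep
    constructor
    · refine fun h => ⟨Or.inr h, ?_⟩
      rintro (h' | h')
      · subst h'
        exact lt_irrefl _ (h a a ha ha)
      · exact (h a b ha hb).asymm (h' b a hb ha)
    · rintro ⟨h | h, h'⟩
      · exact absurd (Or.inl h.symm) h'
      · exact h
  le_total := by
    intro q r
    obtain ⟨a, ha⟩ := q.exists_rep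
    obtain ⟨b, hb⟩ := r.exists_rep
    by_cases hqr : q = r
    · exact Or.inl (Or.inl hqr)
    · subst ha hb
      rcases lt_trichotomy a b with h | h | h
      · exact Or.inl (Or.inr (PhiQuot.lt_of_ne h hqr))
      · exact absurd (congrArg _ h) hqr
      · exact Or.inr (Or.inr (PhiQuot.lt_of_ne h (Ne.symm hqr)))
  toDecidableLE := Classical.decRel _

end PhiEquivalence

/-! ### The ordered power series field and its natural valuation -/

section PowerSeriesField

variable (G : Type u) [AddCommGroup G] [LinearOrder G] [IsOrderedAddMonoid G]

/-- The power series field `ℝ((G))` with its natural ordering, in which a nonzero series is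
positive when its leading coefficient is. -/
def PS : Type u := Lex (HahnSeries G ℝ)

instance : Field (PS G) := inferInstanceAs (Field (Lex (HahnSeries G ℝ)))

instance : LinearOrder (PS G) := inferInstanceAs (LinearOrder (Lex (HahnSeries G ℝ)))

instance : IsStrictOrderedRing (PS G) :=
  inferInstanceAs (IsStrictOrderedRing (Lex (HahnSeries G ℝ)))

/-- The positive elements of `ℝ((G))`, an ordered multiplicative group. -/
abbrev Pos : Type u := {x : PS G // 0 < x}

variable {G}

/-- The underlying formal power series of an element of `ℝ((G))`. -/
def PS.series (x : PS G) : HahnSeries G ℝ := ofLex (show Lex (HahnSeries G ℝ) from x)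

/-- The element of `ℝ((G))` given by a formal power series. -/
def PS.ofSeries (x : HahnSeries G ℝ) : PS G := toLex x

/-- The canonical valuation of `ℝ((G))`: the minimum of the support, and `⊤` at `0`. -/
def val (x : PS G) : WithTop G := x.series.orderTop

/-- The canonical valuation is the natural valuation of the ordered field `ℝ((G))`. -/
theorem val_le_val_iff (x y : PS G) :
    val x ≤ val y ↔ ArchimedeanClass.mk x ≤ ArchimedeanClass.mk y := by
  have h : ∀ z : PS G, val z =
      archimedeanClassOrderIsoWithTop G ℝ (ArchimedeanClass.mk (show Lex (HahnSeries G ℝ) from z)) :=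
    fun z => (archimedeanClassOrderIsoWithTop_apply _).symm
  rw [h, h, OrderIso.le_iff_le]
  exact Iff.rfl

theorem val_mul (x y : PS G) : val (x * y) = val x + val y :=
  HahnSeries.orderTop_mul x.series y.series

theorem val_one : val (1 : PS G) = 0 := HahnSeries.orderTop_one

theorem min_val_le_val_add (x y : PS G) : min (val x) (val y) ≤ val (x + y) :=
  HahnSeries.min_orderTop_le_orderTop_add

theorem val_neg (x : PS G) : val (-x) = val x := HahnSeries.orderTop_neg (x := x.series)

theorem val_le_val_of_le {x y : PS G} (hx : 0 ≤ x) (hxy : x ≤ y) : val y ≤ val x := by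
  rw [val_le_val_iff]
  exact ArchimedeanClass.mk_antitoneOn hx (hx.trans hxy) hxy

/-- The value, an element of `G`, of a positive element of `ℝ((G))`. -/
def vpos (x : Pos G) : G := x.1.series.order

theorem coe_vpos (x : Pos G) : ((vpos x : G) : WithTop G) = val x.1 :=
  HahnSeries.order_eq_orderTop_of_ne_zero (show x.1.series ≠ 0 from x.2.ne')

theorem vpos_mul (x y : Pos G) : vpos (x * y) = vpos x + vpos y := by
  have := val_mul x.1 y.1
  rw [← coe_vpos, ← coe_vpos] at this
  have h2 : val (x.1 * y.1) = ((vpos (x * y) : G) : WithTop G) := (coe_vpos (x * y)).symm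
  rw [h2] at this
  exact_mod_cast this

theorem vpos_one : vpos (1 : Pos G) = 0 := by
  have h : ((vpos (1 : Pos G) : G) : WithTop G) = val (1 : PS G) := coe_vpos 1
  rw [val_one] at h
  exact_mod_cast h

theorem vpos_inv (x : Pos G) : vpos x⁻¹ = - vpos x := by
  have := vpos_mul x x⁻¹
  rw [mul_inv_cancel, vpos_one] at this
  exact (neg_eq_of_add_eq_zero_right this.symm).symm

variable (G) in
/-- The valuation ring `R_v = ℝ[[G]]` of the natural valuation. -/
def valRing : ValuationSubring (PS G) where
  carrier := {x | 0 ≤ val x}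
  mul_mem' := fun {a b} ha hb => by
    show 0 ≤ val (a * b)
    rw [val_mul]
    exact add_nonneg ha hb
  one_mem' := by
    show 0 ≤ val (1 : PS G)
    rw [val_one]
  add_mem' := fun {a b} ha hb => (le_min ha hb).trans (min_val_le_val_add a b)
  zero_mem' := by
    show 0 ≤ val (0 : PS G)
    have : val (0 : PS G) = ⊤ := HahnSeries.orderTop_zero
    rw [this]
    exact le_top
  neg_mem' := fun {a} ha => by
    show 0 ≤ val (-a)
    rw [val_neg]
    exact ha
  mem_or_inv_mem' := fun x => by
    by_cases hx : x = 0
    · left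
      subst hx
      show 0 ≤ val (0 : PS G)
      have : val (0 : PS G) = ⊤ := HahnSeries.orderTop_zero
      rw [this]
      exact le_top
    · by_contra! h
      have h1 : val x < 0 := not_le.1 h.1
      have h2 : val x⁻¹ < 0 := not_le.1 h.2
      have h3 := val_mul x x⁻¹
      rw [mul_inv_cancel₀ hx, val_one] at h3
      lift val x to G using h1.ne_top with g
      lift val x⁻¹ to G using h2.ne_top with g'
      norm_cast at h1 h2 h3
      exact absurd h3 (add_neg h1 h2).ne

theorem mem_valRing {x : PS G} : x ∈ valRing G ↔ 0 ≤ val x := Iff.rfl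

/-- The group `𝒰_w^{>0}` of positive units of a valuation ring `W = R_w`. -/
def posUnits (W : ValuationSubring (PS G)) : Subgroup (Pos G) where
  carrier := {x | x.1 ∈ W ∧ (x⁻¹).1 ∈ W}
  mul_mem' := fun {a b} ha hb => by
    refine ⟨W.mul_mem _ _ ha.1 hb.1, ?_⟩
    have : ((a * b)⁻¹).1 = (a⁻¹).1 * (b⁻¹).1 := by
      rw [mul_inv]
      rfl
    rw [this]
    exact W.mul_mem _ _ ha.2 hb.2
  one_mem' := by
    refine ⟨W.one_mem, ?_⟩
    rw [inv_one]
    exact W.one_mem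
  inv_mem' := fun {a} ha => ⟨ha.2, by rw [inv_inv]; exact ha.1⟩

/-- The group `1 + I_w` of 1-units, as a set of positive elements. -/
def oneUnits (W : ValuationSubring (PS G)) : Set (Pos G) := {x | x.1 - 1 ∈ W.nonunits}

/-! ### Logarithms -/

/-- A (not necessarily surjective) logarithm: an embedding of the ordered group
`(K^{>0}, ·, 1, <)` in `(K, +, 0, <)`. -/
structure IsLogarithm (ℓ : Pos G → PS G) : Prop where
  map_mul : ∀ a b, ℓ (a * b) = ℓ a + ℓ b
  strictMono : StrictMono ℓ

/-- The first condition of compatibility: `ℓ(𝒰_w^{>0}) = R_w ∩ im ℓ`. -/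
def UnitCompat (ℓ : Pos G → PS G) (W : ValuationSubring (PS G)) : Prop :=
  ℓ '' (posUnits W : Set (Pos G)) = (W : Set (PS G)) ∩ Set.range ℓ

/-- Compatibility of `ℓ` and `w`: `ℓ(𝒰_w^{>0}) = R_w ∩ im ℓ` and `ℓ(1 + I_w) = I_w ∩ im ℓ`. -/
def Compat (ℓ : Pos G → PS G) (W : ValuationSubring (PS G)) : Prop :=
  UnitCompat ℓ W ∧ ℓ '' oneUnits W = (W.nonunits : Set (PS G)) ∩ Set.range ℓ

/-- `ℓ` is strong: `v a < v (ℓ a)` for all `a ∈ K^{>0} \ R_v`. -/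
def IsStrong (ℓ : Pos G → PS G) : Prop := ∀ a : Pos G, a.1 ∉ valRing G → val a.1 < val (ℓ a)

variable (G) in
/-- A strong logarithm on `ℝ((G))`, compatible with the natural valuation. -/
structure StrongLog where
  /-- The underlying function. -/
  toFun : Pos G → PS G
  isLogarithm : IsLogarithm toFun
  compat : Compat toFun (valRing G)
  isStrong : IsStrong toFun

instance : CoeFun (StrongLog G) fun _ => Pos G → PS G := ⟨StrongLog.toFun⟩

/-- A strong logarithmic cross-section for `v`: an embedding `h` of the ordered group
`vK = G` in `(K, +, 0, <)` with `h(vK) ∩ R_v = {0}` and `v h(g) > g` for all `g < 0`. -/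
structure IsStrongCrossSection (h : G →+ PS G) : Prop where
  strictMono : StrictMono h
  range_inter : Set.range h ∩ (valRing G : Set (PS G)) = {0}
  strong : ∀ g : G, g < 0 → (g : WithTop G) < val (h g)

/-- `h` is the logarithmic cross-section belonging to `ℓ`: for a group complement `B` of the
positive units of `R_v` in `K^{>0}`, the left logarithm `ℓ|_B` is `h ∘ (-v)`. -/
def GivesRise (h : G →+ PS G) (ℓ : StrongLog G) : Prop :=
  ∃ B : Subgroup (Pos G), IsCompl B (posUnits (valRing G)) ∧ ∀ b ∈ B, ℓ b = h (-vpos b)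

/-! ### The induced map `ζ` on the value set of the value group -/

theorem notMem_valRing_iff {a : Pos G} : a.1 ∉ valRing G ↔ vpos a < 0 := by
  rw [mem_valRing, ← coe_vpos, not_le]
  exact_mod_cast Iff.rfl

theorem mem_posUnits_valRing {a : Pos G} : a ∈ posUnits (valRing G) ↔ vpos a = 0 := by
  have h : a ∈ posUnits (valRing G) ↔ ¬ (a.1 ∉ valRing G) ∧ ¬ ((a⁻¹).1 ∉ valRing G) := by
    rw [not_not, not_not]
    exact Iff.rfl
  rw [h, notMem_valRing_iff, notMem_valRing_iff, vpos_inv, neg_lt_zero, not_lt, not_lt]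
  exact ⟨fun h => le_antisymm h.2 h.1, fun h => ⟨h.ge, h.le⟩⟩

theorem one_lt_of_notMem {a : Pos G} (ha : a.1 ∉ valRing G) : 1 < a := by
  by_contra h
  have h' : a.1 ≤ 1 := not_lt.1 h
  have := val_le_val_of_le a.2.le h'
  rw [val_one] at this
  exact ha this

namespace StrongLog

variable (ℓ : StrongLog G)

theorem map_mul (a b : Pos G) : ℓ (a * b) = ℓ a + ℓ b := ℓ.isLogarithm.map_mul a b

theorem map_one : ℓ 1 = 0 := by
  have := ℓ.map_mul 1 1
  rw [mul_one] at this
  exact left_eq_add.1 this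

theorem map_pow (a : Pos G) (n : ℕ) : ℓ (a ^ n) = n • ℓ a := by
  induction n with
  | zero => rw [pow_zero, zero_nsmul, map_one]
  | succ n ih => rw [pow_succ, map_mul, ih, succ_nsmul]

theorem pos {a : Pos G} (ha : a.1 ∉ valRing G) : 0 < ℓ a := by
  rw [← ℓ.map_one]
  exact ℓ.isLogarithm.strictMono (one_lt_of_notMem ha)

/-- `ℓ` maps positive infinite elements to positive infinite elements. -/
theorem map_notMem {a : Pos G} (ha : a.1 ∉ valRing G) : ℓ a ∉ valRing G := by
  intro h
  have h1 : ℓ a ∈ ℓ '' (posUnits (valRing G) : Set (Pos G)) := by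
    rw [show ℓ '' (posUnits (valRing G) : Set (Pos G)) = _ from ℓ.compat.1]
    exact ⟨h, a, rfl⟩
  obtain ⟨b, hb, hab⟩ := h1
  have := ℓ.isLogarithm.strictMono.injective hab
  subst this
  exact ha hb.1

/-- The value `v (ℓ a) ∈ (vK)^{<0}` for a positive infinite element `a`. -/
def vlog (a : Pos G) (ha : a.1 ∉ valRing G) : G := vpos ⟨ℓ a, ℓ.pos ha⟩

theorem vlog_neg (a : Pos G) (ha : a.1 ∉ valRing G) : ℓ.vlog a ha < 0 :=
  notMem_valRing_iff.1 (ℓ.map_notMem ha)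

/-- `v_G (v a) ≤ v_G (v b)` implies `v (ℓ a) ≤ v (ℓ b)`, so `ℓ` induces monotone maps
`χ` on `(vK)^{<0}` and `ζ` on `v_G vK`. -/
theorem vlog_le_vlog {a b : Pos G} (ha : a.1 ∉ valRing G) (hb : b.1 ∉ valRing G)
    (h : ArchimedeanClass.mk (vpos a) ≤ ArchimedeanClass.mk (vpos b)) :
    ℓ.vlog a ha ≤ ℓ.vlog b hb := by
  obtain ⟨n, hn⟩ := ArchimedeanClass.mk_le_mk.1 h
  have ha' := notMem_valRing_iff.1 ha
  have hb' := notMem_valRing_iff.1 hb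
  rw [abs_of_neg ha', abs_of_neg hb', smul_neg, neg_le_neg_iff] at hn
  have hlt : b < a ^ (n + 1) := by
    have hv : vpos (a ^ (n + 1)) < vpos b := by
      have hp : ∀ m : ℕ, vpos (a ^ m) = m • vpos a := by
        intro m
        induction m with
        | zero => rw [pow_zero, zero_nsmul, vpos_one]
        | succ m ih => rw [pow_succ, vpos_mul, ih, succ_nsmul]
      rw [hp, succ_nsmul]
      exact (add_lt_of_neg_right _ ha').trans_le hn
    by_contra hle
    have := val_le_val_of_le (a ^ (n + 1)).2.le (show (a ^ (n + 1)).1 ≤ b.1 from not_lt.1 hle)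
    rw [← coe_vpos, ← coe_vpos] at this
    exact absurd (WithTop.coe_le_coe.1 this) (not_le.2 hv)
  have h1 := (ℓ.isLogarithm.strictMono hlt).le
  rw [show ℓ.toFun (a ^ (n + 1)) = (n + 1) • ℓ a from ℓ.map_pow a (n + 1)] at h1
  have h2 : val (ℓ a) ≤ val (ℓ b) := by
    rw [val_le_val_iff, ArchimedeanClass.mk_le_mk]
    refine ⟨n + 1, ?_⟩
    rw [abs_of_pos (ℓ.pos ha), abs_of_pos (ℓ.pos hb)]
    exact h1
  have e1 : ((ℓ.vlog a ha : G) : WithTop G) = val (ℓ a) := coe_vpos _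
  have e2 : ((ℓ.vlog b hb : G) : WithTop G) = val (ℓ b) := coe_vpos _
  rw [← e1, ← e2] at h2
  exact_mod_cast h2

/-- `v_G g` for nonzero `g` is the value `v_G (v a)` of some positive infinite `a`. -/
theorem exists_rep (γ : FiniteArchimedeanClass G) :
    ∃ a : Pos G, a.1 ∉ valRing G ∧ ArchimedeanClass.mk (vpos a) = γ.1 := by
  induction γ using FiniteArchimedeanClass.ind with
  | mk g hg =>
    have hpos : (0 : PS G) < PS.ofSeries (single (-|g|) (1 : ℝ)) := by
      have : (0 : Lex (HahnSeries G ℝ)) < toLex (single (-|g|) (1 : ℝ)) := by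
        rw [← leadingCoeff_pos_iff]
        simp
      exact this
    have hv : vpos (⟨_, hpos⟩ : Pos G) = -|g| := by
      show (single (-|g|) (1 : ℝ)).order = -|g|
      exact order_single one_ne_zero
    refine ⟨⟨_, hpos⟩, notMem_valRing_iff.2 ?_, ?_⟩
    · rw [hv]
      simpa using hg
    · rw [hv]
      simp

/-- The map `ζ` induced by `ℓ` on `v_G vK`: `ζ (v_G (v a)) = v_G (v (ℓ a))` for every
`a ∈ K^{>0} \ R_v`. -/
def zeta : FiniteArchimedeanClass G →o FiniteArchimedeanClass G where
  toFun γ := FiniteArchimedeanClass.mk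
    (ℓ.vlog (exists_rep γ).choose (exists_rep γ).choose_spec.1) (ℓ.vlog_neg _ _).ne
  monotone' γ δ h := by
    rw [FiniteArchimedeanClass.mk_le_mk]
    refine ArchimedeanClass.mk_monotoneOn (ℓ.vlog_neg _ _).le (ℓ.vlog_neg _ _).le ?_
    refine ℓ.vlog_le_vlog _ _ ?_
    rw [(exists_rep γ).choose_spec.2, (exists_rep δ).choose_spec.2]
    exact h

theorem zeta_apply (a : Pos G) (ha : a.1 ∉ valRing G) :
    ℓ.zeta (FiniteArchimedeanClass.mk (vpos a) (notMem_valRing_iff.1 ha).ne) =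
      FiniteArchimedeanClass.mk (ℓ.vlog a ha) (ℓ.vlog_neg a ha).ne := by
  set γ := FiniteArchimedeanClass.mk (vpos a) (notMem_valRing_iff.1 ha).ne with hγ
  have hs := (exists_rep γ).choose_spec
  apply Subtype.ext
  show ArchimedeanClass.mk (ℓ.vlog (exists_rep γ).choose hs.1) =
    ArchimedeanClass.mk (ℓ.vlog a ha)
  congr 1
  have h2 : ArchimedeanClass.mk (vpos (exists_rep γ).choose) =
    ArchimedeanClass.mk (vpos a) := hs.2
  exact le_antisymm (ℓ.vlog_le_vlog _ _ h2.le) (ℓ.vlog_le_vlog _ _ h2.ge)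

/-! ### The exponential rank and the principal exponential rank -/

/-- The exponential rank `𝓡_ℓ`: all valuation rings `R_w ⊋ R_v` with
`ℓ(𝒰_w^{>0}) = R_w ∩ im ℓ`, ordered by inclusion. -/
def expRank : Set (ValuationSubring (PS G)) := {W | valRing G < W ∧ UnitCompat ℓ W}

/-- The final segment `ε(R_w) = {[v_G (v a)]_ζ | a ∈ 𝒰_w^{>0} \ 𝒰_v^{>0}}` of
`v_G vK / ∼_ζ`. -/
def eps (W : ValuationSubring (PS G)) : Set (PhiQuot ℓ.zeta) :=
  {q | ∃ a ∈ posUnits W, ∃ ha : a ∉ posUnits (valRing G),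
    q = PhiQuot.mk ℓ.zeta
      (FiniteArchimedeanClass.mk (vpos a) fun h => ha (mem_posUnits_valRing.2 h))}

/-- The principal exponential rank `𝓡_ℓ^pr`: those `R_w ∈ 𝓡_ℓ` for which `ε(R_w)` has a
smallest element, ordered by inclusion. -/
def principalExpRank : Set (ValuationSubring (PS G)) :=
  {W | W ∈ ℓ.expRank ∧ ∃ q, IsLeast (ℓ.eps W) q}

end StrongLog

end PowerSeriesField

end ExpRank

end

/-!
Write `Γ = T ×ₗ ℤ`, with the shift `ζ (t, n) = (t, n + 1)`, and let `G` be the Hahn product of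
copies of `ℝ` over `Γ`. The archimedean classes of `G` form the chain `Γ`, and the classes of `∼_ζ`
are the fibres of `Γ → T`, so `v_G G / ∼_ζ` is `T` (`shiftQuotIso`).

The map `γ ↦ -1_{ζ γ}` is an order embedding of `Γ` in `G`, so relabelling exponents,
`∑ g_γ 1_γ ↦ ∑ g_γ t ^ (-1_{ζ γ})`, embeds the ordered group `G` in `ℝ((G))`. As `ζ γ > γ`, the
value `-1_{ζ γ}` of the image of `g < 0` of class `γ` is infinitesimal against `g`, which makes this
map `h` a strong logarithmic cross-section (`isStrongCrossSection_crossSection`).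

Any strong cross-section `h` gives the strong logarithm
`t^g r (1 + ε) ↦ h(-g) + log r + log (1 + ε)` (`strongLogOfSection`), where `log (1 + ε)` is the
formal series. Its additivity (`logOneAdd_mul`) needs no rearrangement of double sums: the
derivations `t^g ↦ φ(g) t^g`, for additive `φ : G → ℝ`, turn `log` into the logarithmic derivative,
and jointly they kill only the constants. Compatibility does not use that `log` maps onto the
infinitesimals, because `h` has no nonzero finite values.

The logarithm induces `ζ` on `Γ`. A valuation ring above `R_v` corresponds to a convex subgroup of
`G`, that is, to a final segment of `Γ`; it lies in the exponential rank when the segment is stable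
under `ζ` and `ζ⁻¹`, so is the preimage of a final segment of `T`, and it lies in the principal
exponential rank when that final segment of `T` has a least element. This gives
`principalExpRankIso`. The logarithm is not onto when `T` is nonempty: an infinite element
in its image has value `-1_γ` for some `γ`, never `-2 · 1_γ` (`not_surjective_shiftLog`).
-/

noncomputable section

namespace ExpRank

/-! ### The logarithm of 1-units in a Hahn series field -/

section OneUnits

variable {G : Type u} [AddCommGroup G] [LinearOrder G] [IsOrderedAddMonoid G]

/-- The derivation `∑ x_g t^g ↦ ∑ φ(g) x_g t^g` of `ℝ((G))` belonging to an additive map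
`φ : G → ℝ`. -/
def monomialDerivation (φ : G →+ ℝ) : Derivation ℝ (HahnSeries G ℝ) (HahnSeries G ℝ) :=
  Derivation.mk'
    { toFun := fun x =>
        { coeff := fun g => φ g * x.coeff g
          isPWO_support' := x.isPWO_support.mono fun g hg =>
            right_ne_zero_of_mul (Function.mem_support.1 hg) }
      map_add' := fun x y => by
        ext g
        simp [mul_add]
      map_smul' := fun r x => by
        ext g
        simp [mul_left_comm] }
    fun x y => by
      ext g
      set x' : HahnSeries G ℝ :=
        { coeff := fun g => φ g * x.coeff g
          isPWO_support' := x.isPWO_support.mono fun g hg =>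
            right_ne_zero_of_mul (Function.mem_support.1 hg) }
      set y' : HahnSeries G ℝ :=
        { coeff := fun g => φ g * y.coeff g
          isPWO_support' := y.isPWO_support.mono fun g hg =>
            right_ne_zero_of_mul (Function.mem_support.1 hg) }
      have sx : x'.support ⊆ x.support := fun g hg =>
        right_ne_zero_of_mul (Function.mem_support.1 hg)
      have sy : y'.support ⊆ y.support := fun g hg =>
        right_ne_zero_of_mul (Function.mem_support.1 hg)
      change φ g * (x * y).coeff g = (x * y' + y * x').coeff g
      rw [mul_comm y x', coeff_add, coeff_mul, coeff_mul_right' y.isPWO_support sy,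
        coeff_mul_left' x.isPWO_support sx, Finset.mul_sum, ← Finset.sum_add_distrib]
      refine Finset.sum_congr rfl fun ij hij => ?_
      rw [← (Finset.mem_antidiagonal.1 hij).2.2, map_add]
      change _ = x.coeff ij.1 * (φ ij.2 * y.coeff ij.2) + φ ij.1 * x.coeff ij.1 * y.coeff ij.2
      ring

theorem coeff_monomialDerivation (φ : G →+ ℝ) (x : HahnSeries G ℝ) (g : G) :
    (monomialDerivation φ x).coeff g = φ g * x.coeff g := rfl

/-- The family `1, -x/2, x²/3, -x³/4, …`, whose sum times `x` is `log (1 + x)`. -/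
def logFamily (x : HahnSeries G ℝ) : SummableFamily G ℝ ℕ :=
  SummableFamily.smulFamily (fun n : ℕ => (-1 : ℝ) ^ n / (n + 1)) (SummableFamily.powers x)

theorem logFamily_apply {x : HahnSeries G ℝ} (hx : 0 < x.orderTop) (n : ℕ) :
    logFamily x n = ((-1 : ℝ) ^ n / (n + 1)) • x ^ n := by
  rw [logFamily, SummableFamily.smulFamily_toFun, SummableFamily.powers_of_orderTop_pos hx]

/-- The formal logarithm `log (1 + x) = x - x²/2 + x³/3 - …`, for `x` of positive order. -/
def logOneAdd (x : HahnSeries G ℝ) : HahnSeries G ℝ := x * (logFamily x).hsum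

theorem coeff_hsum_logFamily {x : HahnSeries G ℝ} (hx : 0 < x.orderTop) {g : G} (hg : g ≤ 0) :
    (logFamily x).hsum.coeff g = (1 : HahnSeries G ℝ).coeff g := by
  rw [SummableFamily.coeff_hsum, finsum_eq_single _ 0, logFamily_apply hx]
  · simp
  · intro n hn
    rw [logFamily_apply hx, coeff_smul, coeff_eq_zero_of_lt_orderTop, smul_zero]
    refine lt_of_le_of_lt (WithTop.coe_le_coe.2 hg) ?_
    obtain ⟨m, rfl⟩ := Nat.exists_eq_succ_of_ne_zero hn
    clear hn
    induction m with
    | zero => simpa using hx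
    | succ m ih =>
      rw [pow_succ, orderTop_mul]
      exact ih.trans_le (le_add_of_nonneg_right hx.le)

theorem orderTop_hsum_logFamily {x : HahnSeries G ℝ} (hx : 0 < x.orderTop) :
    (logFamily x).hsum.orderTop = 0 := by
  refine orderTop_eq_of_le (g := 0) ?_ fun g hg => ?_
  · rw [mem_support, coeff_hsum_logFamily hx le_rfl]
    simp
  · by_contra h
    rw [not_le] at h
    refine hg ?_
    rw [coeff_hsum_logFamily hx h.le, coeff_one, if_neg h.ne]

theorem orderTop_logOneAdd {x : HahnSeries G ℝ} (hx : 0 < x.orderTop) :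
    (logOneAdd x).orderTop = x.orderTop := by
  rw [logOneAdd, orderTop_mul, orderTop_hsum_logFamily hx, add_zero]

theorem leadingCoeff_logOneAdd {x : HahnSeries G ℝ} (hx : 0 < x.orderTop) :
    (logOneAdd x).leadingCoeff = x.leadingCoeff := by
  have h : (logFamily x).hsum.order = 0 := by
    have h0 : (logFamily x).hsum ≠ 0 := by
      rw [← orderTop_ne_top, orderTop_hsum_logFamily hx]
      exact WithTop.zero_ne_top
    have := order_eq_orderTop_of_ne_zero h0
    rw [orderTop_hsum_logFamily hx] at this
    exact_mod_cast this
  rw [logOneAdd, leadingCoeff_mul, leadingCoeff_eq (x := (logFamily x).hsum), h,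
    coeff_hsum_logFamily hx le_rfl]
  simp

/-- The chain rule `(1 + x) D(log (1 + x)) = D x`. -/
theorem one_add_mul_derivation_logOneAdd (φ : G →+ ℝ) {x : HahnSeries G ℝ}
    (hx : 0 < x.orderTop) :
    (1 + x) * monomialDerivation φ (logOneAdd x) = monomialDerivation φ x := by
  have hx' : 0 < (-x).orderTop := by rwa [orderTop_neg]
  have key : monomialDerivation φ (logOneAdd x) =
      monomialDerivation φ x * (SummableFamily.powers (-x)).hsum := by
    rw [logOneAdd, ← SummableFamily.hsum_smul, ← SummableFamily.hsum_smul]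
    ext g
    rw [coeff_monomialDerivation, SummableFamily.coeff_hsum, SummableFamily.coeff_hsum,
      mul_finsum]
    refine finsum_congr fun n => ?_
    rw [← coeff_monomialDerivation]
    congr 1
    rw [SummableFamily.smul_apply, SummableFamily.smul_apply, of_symm_smul_of_eq_mul,
      of_symm_smul_of_eq_mul, logFamily_apply hx, SummableFamily.powers_of_orderTop_pos hx',
      mul_smul_comm, ← pow_succ', Derivation.map_smul, Derivation.leibniz_pow,
      Nat.add_sub_cancel, smul_eq_mul, neg_pow x, ← Nat.cast_smul_eq_nsmul ℝ, smul_smul]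
    have h1 : (-1 : ℝ) ^ n / (n + 1) * ((n + 1 : ℕ) : ℝ) = (-1) ^ n := by
      push_cast
      field_simp
    have h2 : ((-1 : HahnSeries G ℝ)) ^ n = C ((-1 : ℝ) ^ n) := by
      rw [map_pow, map_neg, map_one]
    rw [h1, h2, C_mul_eq_smul, mul_smul_comm, mul_comm]
  have h := SummableFamily.one_sub_self_mul_hsum_powers hx'
  rw [sub_neg_eq_add] at h
  rw [key, mul_left_comm, h, mul_one]

/-- `log (ab) = log a + log b` for 1-units. The difference of both sides is killed by every
derivation `t^g ↦ φ(g) t^g`, hence is a constant as the maps `φ` separate the points of `G`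
(`hsep`), and it has positive order. -/
theorem logOneAdd_mul (hsep : ∀ g : G, (∀ φ : G →+ ℝ, φ g = 0) → g = 0)
    {a b : HahnSeries G ℝ} (ha : 0 < (a - 1).orderTop) (hb : 0 < (b - 1).orderTop)
    (hab : 0 < (a * b - 1).orderTop) :
    logOneAdd (a * b - 1) = logOneAdd (a - 1) + logOneAdd (b - 1) := by
  have hne : ∀ {c : HahnSeries G ℝ}, 0 < (c - 1).orderTop → c ≠ 0 := by
    rintro c hc rfl
    simp at hc
  have hD : ∀ φ : G →+ ℝ, monomialDerivation φ
      (logOneAdd (a * b - 1) - (logOneAdd (a - 1) + logOneAdd (b - 1))) = 0 := by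
    intro φ
    have h1 := one_add_mul_derivation_logOneAdd φ ha
    have h2 := one_add_mul_derivation_logOneAdd φ hb
    have h3 := one_add_mul_derivation_logOneAdd φ hab
    rw [add_sub_cancel, map_sub, Derivation.map_one_eq_zero, sub_zero] at h1 h2 h3
    rw [Derivation.leibniz, smul_eq_mul, smul_eq_mul] at h3
    rw [map_sub, map_add]
    refine (mul_eq_zero.1 (?_ : a * b * _ = 0)).resolve_left (mul_ne_zero (hne ha) (hne hb))
    linear_combination h3 - b * h1 - a * h2
  rw [← sub_eq_zero]
  ext g
  rw [coeff_zero]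
  by_cases hg : g = 0
  · subst hg
    rw [coeff_sub, coeff_add]
    have h0 : ∀ {x : HahnSeries G ℝ}, 0 < x.orderTop → (logOneAdd x).coeff 0 = 0 := fun hx =>
      coeff_eq_zero_of_lt_orderTop (by rw [orderTop_logOneAdd hx]; exact hx)
    rw [h0 ha, h0 hb, h0 hab]
    simp
  · by_contra hc
    refine hg (hsep g fun φ => ?_)
    have := congrArg (fun z => HahnSeries.coeff z g) (hD φ)
    simp only [coeff_monomialDerivation, coeff_zero] at this
    exact (mul_eq_zero.1 this).resolve_right hc

end OneUnits

/-! ### The strong logarithm arising from a strong logarithmic cross-section -/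

section LogOfCrossSection

variable {G : Type u} [AddCommGroup G] [LinearOrder G] [IsOrderedAddMonoid G]

theorem pos_iff {x : PS G} : 0 < x ↔ 0 < x.series.leadingCoeff :=
  (leadingCoeff_pos_iff (x := (x : Lex (HahnSeries G ℝ)))).symm

theorem mem_nonunits_valRing {x : PS G} : x ∈ (valRing G).nonunits ↔ 0 < val x := by
  rw [ValuationSubring.mem_nonunits_iff_or]
  rcases eq_or_ne x 0 with rfl | hx
  · have : val (0 : PS G) = ⊤ := orderTop_zero
    simp [this]
  · have h := val_mul x x⁻¹
    rw [mul_inv_cancel₀ hx, val_one] at h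
    have h1 : val x ≠ ⊤ := orderTop_ne_top.2 hx
    have h2 : val x⁻¹ ≠ ⊤ := orderTop_ne_top.2 (inv_ne_zero hx)
    rw [mem_valRing, not_le, or_iff_right hx]
    lift val x to G using h1 with g
    lift val x⁻¹ to G using h2 with g'
    norm_cast at h ⊢
    rw [eq_neg_of_add_eq_zero_right h, neg_lt_zero]

theorem val_add_eq_left {x y : PS G} (h : val x < val y) : val (x + y) = val x :=
  orderTop_add_eq_left h

/-- The coefficient `r > 0` in the factorization `a = t^g r (1 + ε)`. -/
def lead (a : Pos G) : ℝ := a.1.series.leadingCoeff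

theorem lead_pos (a : Pos G) : 0 < lead a := pos_iff.1 a.2

theorem lead_mul (a b : Pos G) : lead (a * b) = lead a * lead b :=
  leadingCoeff_mul a.1.series b.1.series

/-- The 1-unit `1 + ε` in the factorization `a = t^g r (1 + ε)`. -/
def oneUnitPart (a : Pos G) : HahnSeries G ℝ := a.1.series * single (-vpos a) (lead a)⁻¹

theorem oneUnitPart_mul (a b : Pos G) :
    oneUnitPart (a * b) = oneUnitPart a * oneUnitPart b := by
  have h : (a * b).1.series = a.1.series * b.1.series := rfl
  have h2 : (single (-(vpos a + vpos b)) (lead a * lead b)⁻¹ : HahnSeries G ℝ) =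
      single (-vpos a) (lead a)⁻¹ * single (-vpos b) (lead b)⁻¹ := by
    rw [single_mul_single, neg_add, mul_inv]
  rw [oneUnitPart, oneUnitPart, oneUnitPart, vpos_mul, lead_mul, h, h2]
  ring

theorem orderTop_oneUnitPart_sub_one_pos (a : Pos G) : 0 < (oneUnitPart a - 1).orderTop := by
  have hl : (lead a)⁻¹ ≠ 0 := inv_ne_zero (lead_pos a).ne'
  rw [orderTop_self_sub_one_pos_iff]
  constructor
  · have h : a.1.series.orderTop = ((vpos a : G) : WithTop G) := (coe_vpos a).symm
    rw [oneUnitPart, orderTop_mul, orderTop_single hl, h, ← WithTop.coe_add, add_neg_cancel,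
      WithTop.coe_zero]
  · rw [oneUnitPart, leadingCoeff_mul, leadingCoeff_of_single]
    exact mul_inv_cancel₀ (lead_pos a).ne'

theorem oneUnitPart_eq {a : Pos G} (h1 : vpos a = 0) (h2 : lead a = 1) :
    oneUnitPart a = a.1.series := by
  rw [oneUnitPart, h1, h2, neg_zero, inv_one]
  exact mul_one _

theorem mem_oneUnits_valRing {a : Pos G} :
    a ∈ oneUnits (valRing G) ↔ vpos a = 0 ∧ lead a = 1 := by
  change a.1 - 1 ∈ (valRing G).nonunits ↔ _
  rw [mem_nonunits_valRing]
  change 0 < (a.1.series - 1).orderTop ↔ _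
  rw [orderTop_self_sub_one_pos_iff]
  have h : a.1.series.orderTop = ((vpos a : G) : WithTop G) := (coe_vpos a).symm
  rw [h]
  norm_cast

/-- The logarithm of the unit `r (1 + ε)` in the factorization `a = t^g r (1 + ε)`. -/
def unitLog (a : Pos G) : PS G :=
  PS.ofSeries (C (Real.log (lead a)) + logOneAdd (oneUnitPart a - 1))

theorem val_unitLog_nonneg (a : Pos G) : 0 ≤ val (unitLog a) := by
  refine le_trans (le_min ?_ ?_) min_orderTop_le_orderTop_add
  · exact orderTop_single_le
  · rw [orderTop_logOneAdd (orderTop_oneUnitPart_sub_one_pos a)]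
    exact (orderTop_oneUnitPart_sub_one_pos a).le

theorem coeff_zero_unitLog (a : Pos G) : (unitLog a).series.coeff 0 = Real.log (lead a) := by
  change (C (Real.log (lead a)) + logOneAdd (oneUnitPart a - 1)).coeff 0 = _
  rw [coeff_add, coeff_eq_zero_of_lt_orderTop (x := logOneAdd _)]
  · simp
  · rw [orderTop_logOneAdd (orderTop_oneUnitPart_sub_one_pos a)]
    exact orderTop_oneUnitPart_sub_one_pos a

theorem unitLog_mul (hsep : ∀ g : G, (∀ φ : G →+ ℝ, φ g = 0) → g = 0) (a b : Pos G) :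
    unitLog (a * b) = unitLog a + unitLog b := by
  have h := logOneAdd_mul hsep (orderTop_oneUnitPart_sub_one_pos a)
    (orderTop_oneUnitPart_sub_one_pos b)
    (by rw [← oneUnitPart_mul]; exact orderTop_oneUnitPart_sub_one_pos _)
  change C (Real.log (lead (a * b))) + logOneAdd (oneUnitPart (a * b) - 1) =
    (C (Real.log (lead a)) + logOneAdd (oneUnitPart a - 1)) +
      (C (Real.log (lead b)) + logOneAdd (oneUnitPart b - 1))
  rw [oneUnitPart_mul, h, lead_mul, Real.log_mul (lead_pos a).ne' (lead_pos b).ne', map_add]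
  ring

/-- The logarithm is positive on the units `r (1 + ε) > 1`: if `r > 1`, its leading coefficient
is `log r`, and if `r = 1`, it is that of `ε`. -/
theorem unitLog_pos {a : Pos G} (ha : 1 < a) (hv : vpos a = 0) : 0 < unitLog a := by
  have hu := orderTop_oneUnitPart_sub_one_pos a
  have ho : a.1.series.orderTop = 0 := by
    have h : a.1.series.orderTop = ((vpos a : G) : WithTop G) := (coe_vpos a).symm
    rw [h, hv, WithTop.coe_zero]
  have ha' : 0 < (a.1.series - 1).leadingCoeff :=
    pos_iff.1 (sub_pos.2 (show (1 : PS G) < a.1 from ha))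
  rw [pos_iff]
  change 0 < (C (Real.log (lead a)) + logOneAdd (oneUnitPart a - 1)).leadingCoeff
  by_cases h1 : lead a = 1
  · rw [h1, Real.log_one, map_zero, zero_add, leadingCoeff_logOneAdd hu, oneUnitPart_eq hv h1]
    exact ha'
  · have hc0 : (a.1.series - 1).coeff 0 = lead a - 1 := by
      rw [coeff_sub, coeff_one, if_pos rfl, lead, leadingCoeff_eq]
      exact congrArg (fun g => a.1.series.coeff g - 1) hv.symm
    have hge : 0 ≤ (a.1.series - 1).orderTop := by
      refine le_trans (le_min ho.ge ?_) min_orderTop_le_orderTop_sub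
      rw [orderTop_one]
    have hot : (a.1.series - 1).orderTop = ((0 : G) : WithTop G) := by
      refine orderTop_eq_of_le ?_ fun g hg => ?_
      · rw [mem_support, hc0]
        exact sub_ne_zero.2 h1
      · exact_mod_cast hge.trans (orderTop_le_of_coeff_ne_zero hg)
    have hlt : 1 < lead a := by
      have hne : a.1.series - 1 ≠ 0 := leadingCoeff_ne_zero.1 ha'.ne'
      have hord : (a.1.series - 1).order = 0 :=
        WithTop.coe_injective ((order_eq_orderTop_of_ne_zero hne).trans hot)
      rw [leadingCoeff_eq, hord, hc0] at ha'
      exact sub_pos.1 ha'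
    have hlog : 0 < Real.log (lead a) := Real.log_pos hlt
    rw [leadingCoeff_add_eq_left]
    · rw [C_apply, leadingCoeff_of_single]
      exact hlog
    · rw [C_apply, orderTop_single hlog.ne', orderTop_logOneAdd hu]
      exact hu

/-- The logarithm `t^g r (1 + ε) ↦ h(-g) + log r + log (1 + ε)` given by a cross-section `h`. -/
def logOfSection (h : G →+ PS G) (a : Pos G) : PS G := h (-vpos a) + unitLog a

theorem IsStrongCrossSection.val_neg {h : G →+ PS G} (hh : IsStrongCrossSection h) {g : G}
    (hg : g ≠ 0) : val (h g) < 0 := by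
  by_contra hn
  have : h g ∈ Set.range h ∩ (valRing G : Set (PS G)) :=
    ⟨⟨g, rfl⟩, mem_valRing.2 (not_lt.1 hn)⟩
  rw [hh.range_inter] at this
  exact hg (hh.strictMono.injective (this.trans h.map_zero.symm))

theorem val_logOfSection {h : G →+ PS G} (hh : IsStrongCrossSection h) {a : Pos G}
    (ha : vpos a ≠ 0) : val (logOfSection h a) = val (h (vpos a)) := by
  have h1 : val (h (-vpos a)) = val (h (vpos a)) := by rw [map_neg, ExpRank.val_neg]
  rw [logOfSection, val_add_eq_left, h1]
  rw [h1]
  exact (hh.val_neg ha).trans_le (val_unitLog_nonneg a)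

theorem logOfSection_of_vpos_eq_zero (h : G →+ PS G) {a : Pos G} (ha : vpos a = 0) :
    logOfSection h a = unitLog a := by
  rw [logOfSection, ha, neg_zero, map_zero, zero_add]

theorem logOfSection_mul (hsep : ∀ g : G, (∀ φ : G →+ ℝ, φ g = 0) → g = 0) (h : G →+ PS G)
    (a b : Pos G) : logOfSection h (a * b) = logOfSection h a + logOfSection h b := by
  rw [logOfSection, logOfSection, logOfSection, unitLog_mul hsep, vpos_mul, neg_add, map_add]
  ring

theorem vpos_nonpos_of_one_lt {a : Pos G} (ha : 1 < a) : vpos a ≤ 0 := by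
  have := val_le_val_of_le zero_le_one (show (1 : PS G) ≤ a.1 from ha.le)
  rw [val_one, ← coe_vpos] at this
  exact_mod_cast this

theorem logOfSection_pos {h : G →+ PS G} (hh : IsStrongCrossSection h) {a : Pos G}
    (ha : 1 < a) : 0 < logOfSection h a := by
  rcases (vpos_nonpos_of_one_lt ha).lt_or_eq with hv | hv
  · have h0 : 0 < h (-vpos a) := by
      rw [← h.map_zero]
      exact hh.strictMono (neg_pos.2 hv)
    rw [pos_iff] at h0 ⊢
    have hlt : (h (-vpos a)).series.orderTop < (unitLog a).series.orderTop :=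
      (hh.val_neg (neg_ne_zero.2 hv.ne)).trans_le (val_unitLog_nonneg a)
    have := leadingCoeff_add_eq_left hlt
    exact h0.trans_eq this.symm
  · rw [logOfSection_of_vpos_eq_zero h hv]
    exact unitLog_pos ha hv

theorem logOfSection_strictMono (hsep : ∀ g : G, (∀ φ : G →+ ℝ, φ g = 0) → g = 0)
    {h : G →+ PS G} (hh : IsStrongCrossSection h) : StrictMono (logOfSection h) := by
  intro a b hab
  have h1 := logOfSection_pos hh (one_lt_div'.2 hab)
  have h2 := logOfSection_mul hsep h (b / a) a
  rw [div_mul_cancel] at h2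
  rw [h2]
  exact lt_add_of_pos_left _ h1

theorem image_eq_inter_range_iff {α β : Type*} {f : α → β} (hf : Function.Injective f)
    {s : Set α} {t : Set β} : f '' s = t ∩ Set.range f ↔ ∀ a, a ∈ s ↔ f a ∈ t := by
  rw [← Set.image_preimage_eq_inter_range, hf.image_injective.eq_iff, Set.ext_iff]
  rfl

/-- The strong logarithm arising from a strong logarithmic cross-section. -/
def strongLogOfSection (hsep : ∀ g : G, (∀ φ : G →+ ℝ, φ g = 0) → g = 0)
    {h : G →+ PS G} (hh : IsStrongCrossSection h) : StrongLog G where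
  toFun := logOfSection h
  isLogarithm := ⟨logOfSection_mul hsep h, logOfSection_strictMono hsep hh⟩
  compat := by
    have hinj := (logOfSection_strictMono hsep hh).injective
    refine ⟨(image_eq_inter_range_iff hinj).2 fun a => ?_,
      (image_eq_inter_range_iff hinj).2 fun a => ?_⟩
    · rw [SetLike.mem_coe, SetLike.mem_coe, mem_posUnits_valRing, mem_valRing]
      by_cases hv : vpos a = 0
      · rw [logOfSection_of_vpos_eq_zero h hv]
        exact iff_of_true hv (val_unitLog_nonneg a)
      · rw [val_logOfSection hh hv]
        exact iff_of_false hv (hh.val_neg hv).not_ge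
    · rw [SetLike.mem_coe, mem_nonunits_valRing, mem_oneUnits_valRing]
      by_cases hv : vpos a = 0
      · rw [logOfSection_of_vpos_eq_zero h hv, and_iff_right hv]
        constructor
        · intro hl
          have hu := orderTop_oneUnitPart_sub_one_pos a
          change 0 < (C (Real.log (lead a)) + logOneAdd (oneUnitPart a - 1)).orderTop
          rwa [hl, Real.log_one, map_zero, zero_add, orderTop_logOneAdd hu]
        · intro hpos
          have h0 := coeff_zero_unitLog a
          rw [coeff_eq_zero_of_lt_orderTop hpos] at h0
          exact Real.eq_one_of_pos_of_log_eq_zero (lead_pos a) h0.symm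
      · rw [val_logOfSection hh hv]
        exact iff_of_false (fun h => hv h.1) (hh.val_neg hv).not_gt
  isStrong := fun a ha => by
    have hv := notMem_valRing_iff.1 ha
    rw [val_logOfSection hh hv.ne, ← coe_vpos]
    exact hh.strong _ hv

/-- The positive monomial `t^g`. -/
def monomial (g : G) : Pos G :=
  ⟨PS.ofSeries (single g 1), pos_iff.2 <| by
    change 0 < (single g (1 : ℝ)).leadingCoeff
    rw [leadingCoeff_of_single]
    exact one_pos⟩

theorem vpos_monomial (g : G) : vpos (monomial g) = g := order_single one_ne_zero

theorem val_monomial (g : G) : val (monomial g).1 = g := by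
  rw [← coe_vpos, vpos_monomial]

theorem unitLog_monomial (g : G) : unitLog (monomial g) = 0 := by
  have hl : lead (monomial g) = 1 := leadingCoeff_of_single
  have hu : oneUnitPart (monomial g) = 1 := by
    rw [oneUnitPart, hl, vpos_monomial]
    change single g (1 : ℝ) * single (-g) (1 : ℝ)⁻¹ = 1
    rw [single_mul_single, add_neg_cancel, inv_one, one_mul]
    rfl
  rw [unitLog, hl, hu, Real.log_one, map_zero, sub_self, logOneAdd, zero_mul, add_zero]
  rfl

theorem logOfSection_monomial (h : G →+ PS G) (g : G) :
    logOfSection h (monomial g) = h (-g) := by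
  rw [logOfSection, unitLog_monomial, vpos_monomial, add_zero]

theorem monomial_mul (g g' : G) : monomial g * monomial g' = monomial (g + g') := by
  have h : single g (1 : ℝ) * single g' 1 = single (g + g') 1 := by
    rw [single_mul_single, one_mul]
  exact Subtype.ext h

/-- The group of positive monomials is a complement of the positive units. -/
theorem givesRise_strongLogOfSection (hsep : ∀ g : G, (∀ φ : G →+ ℝ, φ g = 0) → g = 0)
    {h : G →+ PS G} (hh : IsStrongCrossSection h) :
    GivesRise h (strongLogOfSection hsep hh) := by
  have hone : monomial (0 : G) = 1 := rfl
  let B : Subgroup (Pos G) :=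
    { carrier := Set.range monomial
      mul_mem' := by
        rintro _ _ ⟨g, rfl⟩ ⟨g', rfl⟩
        exact ⟨g + g', (monomial_mul g g').symm⟩
      one_mem' := ⟨0, hone⟩
      inv_mem' := by
        rintro _ ⟨g, rfl⟩
        refine ⟨-g, eq_inv_of_mul_eq_one_left ?_⟩
        rw [monomial_mul, neg_add_cancel, hone] }
  refine ⟨B, IsCompl.of_eq ?_ ?_, ?_⟩
  · rw [eq_bot_iff]
    rintro _ ⟨⟨g, rfl⟩, hu⟩
    have hu' := mem_posUnits_valRing.1 hu
    rw [vpos_monomial] at hu'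
    rw [hu', hone]
    exact one_mem _
  · rw [eq_top_iff]
    intro a _
    have hmem : (monomial (vpos a))⁻¹ * a ∈ posUnits (valRing G) := by
      rw [mem_posUnits_valRing, vpos_mul, vpos_inv, vpos_monomial, neg_add_cancel]
    have hB : monomial (vpos a) ∈ B := ⟨vpos a, rfl⟩
    have := Subgroup.mul_mem_sup hB hmem
    rwa [mul_inv_cancel_left] at this
  · rintro _ ⟨g, rfl⟩
    rw [vpos_monomial]
    exact logOfSection_monomial h g

end LogOfCrossSection

/-! ### The quotient by `∼_φ` for shift maps -/

section Shift

variable {S : Type u} [LinearOrder S] {T : Type u} [LinearOrder T]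

/-- A monotone surjection whose fibres are the classes of `∼_φ` identifies `S/∼_φ`. -/
def phiQuotIso (φ : S →o S) (π : S → T) (hmono : Monotone π) (hsurj : Function.Surjective π)
    (h : ∀ a b, PhiRel φ a b ↔ π a = π b) : PhiQuot φ ≃o T :=
  StrictMono.orderIsoOfSurjective
    (Quotient.lift (s := phiSetoid φ) π fun a b hab => (h a b).1 hab : PhiQuot φ → T)
    (by
      intro q r hqr
      obtain ⟨a, rfl⟩ := q.exists_rep
      obtain ⟨b, rfl⟩ := r.exists_rep
      refine lt_of_le_of_ne (hmono (hqr a b rfl rfl).le) fun he => hqr.ne ?_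
      exact PhiQuot.mk_eq.2 ((h a b).2 he))
    (fun t => (hsurj t).imp' (PhiQuot.mk φ) fun _ ha => ha)

/-- The order automorphism `(t, n) ↦ (t, n + 1)` of the lexicographic product `T ×ₗ ℤ`. -/
def shift (T : Type u) [LinearOrder T] : T ×ₗ ℤ ≃o T ×ₗ ℤ where
  toFun γ := toLex ((ofLex γ).1, (ofLex γ).2 + 1)
  invFun γ := toLex ((ofLex γ).1, (ofLex γ).2 - 1)
  left_inv γ := by simp
  right_inv γ := by simp
  map_rel_iff' {γ δ} := by simp [Prod.Lex.le_iff]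

theorem lt_shift (γ : T ×ₗ ℤ) : γ < shift T γ := by
  rw [Prod.Lex.lt_iff]
  exact Or.inr ⟨rfl, lt_add_one _⟩

theorem fst_shift (γ : T ×ₗ ℤ) : (ofLex (shift T γ)).1 = (ofLex γ).1 := rfl

/-- If `φ` is conjugate to the shift of `T ×ₗ ℤ`, then the classes of `∼_φ` are the fibres of the
projection to `T`. -/
theorem phiRel_iff_fst_eq {φ : S →o S} (e : S ≃o T ×ₗ ℤ) (he : ∀ a, e (φ a) = shift T (e a))
    (a b : S) : PhiRel φ a b ↔ (ofLex (e a)).1 = (ofLex (e b)).1 := by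
  have hit : ∀ (n : ℕ) (a : S),
      e (φ^[n] a) = toLex ((ofLex (e a)).1, (ofLex (e a)).2 + (n : ℤ)) := by
    intro n a
    induction n with
    | zero => simp
    | succ n ih =>
      rw [Function.iterate_succ_apply', he, ih]
      simp [shift, add_assoc]
  have hle : ∀ a b : S, (∃ m n, φ^[m] a ≤ φ^[n] b) ↔ (ofLex (e a)).1 ≤ (ofLex (e b)).1 := by
    intro a b
    constructor
    · rintro ⟨m, n, hmn⟩
      rw [← e.le_iff_le, hit, hit, Prod.Lex.le_iff] at hmn
      rcases hmn with h | h
      · exact h.le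
      · exact h.1.le
    · intro h
      refine ⟨0, ((ofLex (e a)).2 - (ofLex (e b)).2).toNat, ?_⟩
      rw [← e.le_iff_le, hit, hit, Prod.Lex.le_iff]
      rcases h.lt_or_eq with h | h
      · exact Or.inl h
      · refine Or.inr ⟨h, ?_⟩
        have := Int.self_le_toNat ((ofLex (e a)).2 - (ofLex (e b)).2)
        simp only [ofLex_toLex]
        push_cast
        omega
  rw [phiRel_iff, hle, hle]
  exact le_antisymm_iff.symm

/-- If `φ` is conjugate to the shift of `T ×ₗ ℤ`, then `S/∼_φ` is isomorphic to `T`. -/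
def shiftQuotIso {φ : S →o S} (e : S ≃o T ×ₗ ℤ) (he : ∀ a, e (φ a) = shift T (e a)) :
    PhiQuot φ ≃o T :=
  phiQuotIso φ (fun a => (ofLex (e a)).1)
    (fun a b hab => by
      rcases Prod.Lex.le_iff.1 (e.monotone hab) with h | h
      · exact h.le
      · exact h.1.le)
    (fun t => ⟨e.symm (toLex (t, 0)), by simp⟩) (phiRel_iff_fst_eq e he)

theorem shiftQuotIso_mk {φ : S →o S} (e : S ≃o T ×ₗ ℤ) (he : ∀ a, e (φ a) = shift T (e a))
    (a : S) : shiftQuotIso e he (PhiQuot.mk φ a) = (ofLex (e a)).1 := rfl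

end Shift

/-! ### Valuation rings containing the natural valuation ring -/

section Overrings

variable {G : Type u} [AddCommGroup G] [LinearOrder G] [IsOrderedAddMonoid G]

theorem mem_of_val_le {W : ValuationSubring (PS G)} (hW : valRing G ≤ W) {x y : PS G}
    (hx : x ∈ W) (h : val x ≤ val y) : y ∈ W := by
  rcases eq_or_ne x 0 with rfl | hx0
  · have h0 : val (0 : PS G) = ⊤ := orderTop_zero
    rw [h0, top_le_iff] at h
    have : y = 0 := orderTop_eq_top.1 h
    rw [this]
    exact W.zero_mem
  · have hmul := val_mul x (x⁻¹ * y)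
    rw [mul_inv_cancel_left₀ hx0] at hmul
    rw [← mul_inv_cancel_left₀ hx0 y]
    refine W.mul_mem _ _ hx (hW (mem_valRing.2 ?_))
    rw [hmul] at h
    have h1 : val x ≠ ⊤ := orderTop_ne_top.2 hx0
    lift val x to G using h1 with g
    generalize val (x⁻¹ * y) = z at h
    cases z with
    | top => exact le_top
    | coe z =>
      norm_cast at h ⊢
      exact le_add_iff_nonneg_right g |>.1 h

/-- Whether infinite elements lie in an overring of `R_v` depends only on the archimedean class of
their value, since the ring is closed under powers. -/
theorem mem_of_mk_val_le {W : ValuationSubring (PS G)} (hW : valRing G ≤ W) {x y : PS G}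
    {g g' : G} (hx : x ∈ W) (hxg : val x = g) (hg : g ≤ 0) (hyg : val y = g')
    (h : ArchimedeanClass.mk g ≤ ArchimedeanClass.mk g') : y ∈ W := by
  obtain ⟨n, hn⟩ := ArchimedeanClass.mk_le_mk.1 h
  refine mem_of_val_le hW (pow_mem hx n) ?_
  have hp : val (x ^ n) = ((n • g : G) : WithTop G) := by
    clear hn
    induction n with
    | zero => rw [pow_zero, zero_nsmul, val_one, WithTop.coe_zero]
    | succ n ih => rw [pow_succ, val_mul, ih, hxg, succ_nsmul, WithTop.coe_add]
  rw [hp, hyg, WithTop.coe_le_coe]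
  rw [abs_of_nonpos hg, smul_neg] at hn
  exact (le_neg.1 hn).trans (neg_abs_le g')

/-- Elements of `W` of nonpositive value are units, as their inverses are in `R_v`. -/
theorem mem_posUnits_of_mem {W : ValuationSubring (PS G)} (hW : valRing G ≤ W) {a : Pos G}
    (ha : a.1 ∈ W) (hv : vpos a ≤ 0) : a ∈ posUnits W := by
  refine ⟨ha, hW (mem_valRing.2 ?_)⟩
  rw [← coe_vpos, vpos_inv]
  exact_mod_cast neg_nonneg.2 hv

/-- The overring of `R_v` whose values are bounded below by elements of the subgroup `H`. It is
the valuation ring belonging to the convex hull of `H`. -/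
def overring (H : AddSubgroup G) : ValuationSubring (PS G) :=
  ValuationSubring.ofLE (valRing G)
    { carrier := {x | ∃ g ∈ H, (g : WithTop G) ≤ val x}
      mul_mem' := by
        rintro x y ⟨g, hg, hx⟩ ⟨g', hg', hy⟩
        refine ⟨g + g', H.add_mem hg hg', ?_⟩
        rw [val_mul, WithTop.coe_add]
        exact add_le_add hx hy
      one_mem' := ⟨0, H.zero_mem, by rw [val_one, WithTop.coe_zero]⟩
      add_mem' := by
        rintro x y ⟨g, hg, hx⟩ ⟨g', hg', hy⟩
        refine ⟨min g g', by rcases min_choice g g' with h | h <;> rwa [h], ?_⟩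
        exact le_trans (le_min ((WithTop.coe_le_coe.2 (min_le_left _ _)).trans hx)
          ((WithTop.coe_le_coe.2 (min_le_right _ _)).trans hy)) (min_val_le_val_add x y)
      zero_mem' := ⟨0, H.zero_mem, by
        have h0 : val (0 : PS G) = ⊤ := orderTop_zero
        rw [h0]
        exact le_top⟩
      neg_mem' := by
        rintro x ⟨g, hg, hx⟩
        exact ⟨g, hg, by rwa [val_neg]⟩ }
    fun _ hx => ⟨0, H.zero_mem, hx⟩

theorem mem_overring {H : AddSubgroup G} {x : PS G} :
    x ∈ overring H ↔ ∃ g ∈ H, (g : WithTop G) ≤ val x := Iff.rfl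

theorem valRing_le_overring (H : AddSubgroup G) : valRing G ≤ overring H :=
  fun _ hx => ⟨0, H.zero_mem, hx⟩

end Overrings

/-! ### The value group -/

section ValueGroup

variable (T : Type u) [LinearOrder T]

/-- The Hahn product of copies of `ℝ` over `T ×ₗ ℤ`, ordered lexicographically. -/
abbrev ValueGroup : Type u := Lex (HahnSeries (T ×ₗ ℤ) ℝ)

/-- The isomorphism of the chain of archimedean classes with `T ×ₗ ℤ`. -/
abbrev classIso : FiniteArchimedeanClass (ValueGroup T) ≃o T ×ₗ ℤ :=
  finiteArchimedeanClassOrderIso (T ×ₗ ℤ) ℝ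

variable {T}

theorem exists_nsmul_eq {n : ℕ} (hn : n ≠ 0) (g : ValueGroup T) :
    ∃ g' : ValueGroup T, n • g' = g := by
  have h : n • ((n : ℝ)⁻¹ • ofLex g) = ofLex g := by
    rw [← Nat.cast_smul_eq_nsmul ℝ, smul_smul, mul_inv_cancel₀ (Nat.cast_ne_zero.2 hn), one_smul]
  exact ⟨toLex ((n : ℝ)⁻¹ • ofLex g), congrArg toLex h⟩

theorem eq_zero_of_forall_hom {g : ValueGroup T} (h : ∀ φ : ValueGroup T →+ ℝ, φ g = 0) :
    g = 0 := by
  have : ofLex g = 0 := by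
    ext γ
    let c : ValueGroup T →+ ℝ :=
      { toFun := fun x => (ofLex x).coeff γ
        map_zero' := rfl
        map_add' := fun _ _ => rfl }
    exact h c
  exact this

/-- The negative element of the value group that has archimedean class `γ` and coefficient `-1`. -/
def negUnit : T ×ₗ ℤ ↪o ValueGroup T :=
  OrderEmbedding.ofStrictMono (fun γ => -toLex (single γ (1 : ℝ))) fun γ δ h => by
    rw [neg_lt_neg_iff, HahnSeries.lt_iff]
    refine ⟨γ, fun j hj => ?_, ?_⟩
    · simp [coeff_single_of_ne hj.ne, coeff_single_of_ne (hj.trans h).ne]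
    · simp [coeff_single_of_ne h.ne]

theorem orderTop_negUnit (γ : T ×ₗ ℤ) : (ofLex (negUnit γ)).orderTop = γ := by
  change (-single γ (1 : ℝ)).orderTop = γ
  rw [orderTop_neg, orderTop_single one_ne_zero]

theorem negUnit_neg (γ : T ×ₗ ℤ) : negUnit γ < 0 := by
  change -toLex (single γ (1 : ℝ)) < 0
  rw [neg_lt_zero, ← leadingCoeff_pos_iff]
  simp

theorem classIso_mk_eq_iff {g : ValueGroup T} (hg : g ≠ 0) (γ : T ×ₗ ℤ) :
    classIso T (FiniteArchimedeanClass.mk g hg) = γ ↔ (ofLex g).orderTop = γ := by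
  rw [← finiteArchimedeanClassOrderIso_apply hg, WithTop.coe_inj]

theorem classIso_negUnit (γ : T ×ₗ ℤ) :
    classIso T (FiniteArchimedeanClass.mk (negUnit γ) (negUnit_neg γ).ne) = γ :=
  (classIso_mk_eq_iff _ _).2 (orderTop_negUnit γ)

theorem mk_le_mk_iff_classIso {g g' : ValueGroup T} (hg : g ≠ 0) (hg' : g' ≠ 0) :
    ArchimedeanClass.mk g ≤ ArchimedeanClass.mk g' ↔
      classIso T (FiniteArchimedeanClass.mk g hg) ≤
        classIso T (FiniteArchimedeanClass.mk g' hg') := by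
  rw [OrderIso.le_iff_le, FiniteArchimedeanClass.mk_le_mk]

theorem fst_mono {γ δ : T ×ₗ ℤ} (h : γ ≤ δ) : (ofLex γ).1 ≤ (ofLex δ).1 := by
  rcases Prod.Lex.le_iff.1 h with h | h
  · exact h.le
  · exact h.1.le

/-- The convex subgroup of the series with support in the final segment of `T ×ₗ ℤ` over
`{s | t ≤ s}`. -/
def convexSubgroup (t : T) : AddSubgroup (ValueGroup T) where
  carrier := {g | ∀ γ : T ×ₗ ℤ, (ofLex γ).1 < t → (ofLex g).coeff γ = 0}
  zero_mem' := fun _ _ => rfl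
  add_mem' := fun {g g'} hg hg' γ hγ => by
    rw [ofLex_add, coeff_add, hg γ hγ, hg' γ hγ, add_zero]
  neg_mem' := fun {g} hg γ hγ => by
    rw [ofLex_neg, coeff_neg, hg γ hγ, neg_zero]

theorem mem_convexSubgroup {t : T} {g : ValueGroup T} (hg : g ≠ 0) :
    g ∈ convexSubgroup t ↔ t ≤ (ofLex (classIso T (FiniteArchimedeanClass.mk g hg))).1 := by
  set γ := classIso T (FiniteArchimedeanClass.mk g hg)
  have ho : (ofLex g).orderTop = γ := (classIso_mk_eq_iff hg γ).1 rfl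
  constructor
  · intro h
    by_contra hlt
    exact coeff_orderTop_ne ho (h γ (not_le.1 hlt))
  · intro h δ hδ
    refine coeff_eq_zero_of_lt_orderTop ?_
    rw [ho, WithTop.coe_lt_coe]
    by_contra hle
    exact (h.trans (fst_mono (not_lt.1 hle))).not_gt hδ

theorem mem_convexSubgroup_of_mk_le {t : T} {g g' : ValueGroup T} (hg : g ∈ convexSubgroup t)
    (h : ArchimedeanClass.mk g ≤ ArchimedeanClass.mk g') : g' ∈ convexSubgroup t := by
  rcases eq_or_ne g' 0 with rfl | hg'
  · exact zero_mem _
  · have hg0 : g ≠ 0 := by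
      rintro rfl
      rw [ArchimedeanClass.mk_zero, top_le_iff, ArchimedeanClass.mk_eq_top_iff] at h
      exact hg' h
    rw [mem_convexSubgroup hg0] at hg
    rw [mem_convexSubgroup hg']
    exact hg.trans (fst_mono ((mk_le_mk_iff_classIso hg0 hg').1 h))

theorem negUnit_mem_convexSubgroup {t : T} {γ : T ×ₗ ℤ} :
    negUnit γ ∈ convexSubgroup t ↔ t ≤ (ofLex γ).1 := by
  rw [mem_convexSubgroup (negUnit_neg γ).ne, classIso_negUnit]

theorem mem_overring_convexSubgroup {t : T} {x : PS (ValueGroup T)} {g : ValueGroup T}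
    (hx : val x = g) (hg : g ≤ 0) :
    x ∈ overring (convexSubgroup t) ↔ g ∈ convexSubgroup t := by
  rw [mem_overring]
  constructor
  · rintro ⟨g', hg', hle⟩
    rw [hx, WithTop.coe_le_coe] at hle
    exact mem_convexSubgroup_of_mk_le hg'
      (ArchimedeanClass.mk_monotoneOn (hle.trans hg) hg hle)
  · exact fun h => ⟨g, h, hx.ge⟩

/-- The condition on both `a` and `a⁻¹` cuts out a convex set of values, so it says
`vpos a ∈ H` exactly, since the subgroup `H` is convex. -/
theorem mem_posUnits_overring {t : T} {a : Pos (ValueGroup T)} :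
    a ∈ posUnits (overring (convexSubgroup t)) ↔ vpos a ∈ convexSubgroup t := by
  have hi : val (a⁻¹).1 = ((-vpos a : ValueGroup T) : WithTop (ValueGroup T)) := by
    rw [← coe_vpos, vpos_inv]
  constructor
  · intro h
    rcases le_total (vpos a) 0 with hv | hv
    · exact (mem_overring_convexSubgroup (coe_vpos a).symm hv).1 h.1
    · exact neg_mem_iff.1 ((mem_overring_convexSubgroup hi (neg_nonpos.2 hv)).1 h.2)
  · intro h
    exact ⟨⟨_, h, (coe_vpos a).le⟩, ⟨_, neg_mem h, hi.ge⟩⟩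

/-! ### The cross-section and its logarithm -/

variable (T) in
/-- The cross-section `∑ g_γ 1_γ ↦ ∑ g_γ t ^ (-1_{ζ γ})`, where `ζ` is the shift. -/
def crossSection : ValueGroup T →+ PS (ValueGroup T) where
  toFun g := PS.ofSeries (embDomain ((shift T).toOrderEmbedding.trans negUnit) (ofLex g))
  map_zero' := embDomain_zero
  map_add' g g' := embDomain_add _ (ofLex g) (ofLex g')

theorem val_crossSection {g : ValueGroup T} (hg : g ≠ 0) :
    val (crossSection T g) =
      negUnit (shift T (classIso T (FiniteArchimedeanClass.mk g hg))) := by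
  have ho := (classIso_mk_eq_iff hg _).1 rfl
  change (embDomain ((shift T).toOrderEmbedding.trans negUnit) (ofLex g)).orderTop = _
  rw [orderTop_embDomain, ho]
  rfl

theorem mk_lt_mk_negUnit_shift {g : ValueGroup T} (hg : g ≠ 0) :
    ArchimedeanClass.mk g < ArchimedeanClass.mk
      (negUnit (shift T (classIso T (FiniteArchimedeanClass.mk g hg)))) := by
  rw [← not_le, mk_le_mk_iff_classIso (negUnit_neg (T := T) _).ne hg, classIso_negUnit, not_le]
  exact lt_shift _

variable (T) in
theorem isStrongCrossSection_crossSection : IsStrongCrossSection (crossSection T) where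
  strictMono := fun _ _ hlt => (embDomainOrderEmbedding (R := ℝ)
    ((shift T).toOrderEmbedding.trans negUnit)).strictMono hlt
  range_inter := by
    ext x
    constructor
    · rintro ⟨⟨g, rfl⟩, hx⟩
      by_contra hne
      have hg : g ≠ 0 := by
        rintro rfl
        exact hne (map_zero _)
      have hx' := mem_valRing.1 hx
      rw [val_crossSection hg] at hx'
      exact (negUnit_neg (T := T) _).not_ge (by exact_mod_cast hx')
    · rintro rfl
      exact ⟨⟨0, map_zero _⟩, zero_mem _⟩
  strong := fun g hg => by
    rw [val_crossSection hg.ne, WithTop.coe_lt_coe]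
    by_contra hle
    exact (mk_lt_mk_negUnit_shift hg.ne).not_ge
      (ArchimedeanClass.mk_monotoneOn (negUnit_neg (T := T) _).le hg.le (not_lt.1 hle))

variable (T) in
/-- The strong logarithm arising from `crossSection T`. -/
def shiftLog : StrongLog (ValueGroup T) :=
  strongLogOfSection (fun _ => eq_zero_of_forall_hom) (isStrongCrossSection_crossSection T)

theorem val_shiftLog {a : Pos (ValueGroup T)} (ha : vpos a ≠ 0) :
    val (shiftLog T a) =
      negUnit (shift T (classIso T (FiniteArchimedeanClass.mk (vpos a) ha))) :=
  (val_logOfSection (isStrongCrossSection_crossSection T) ha).trans (val_crossSection ha)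

theorem val_shiftLog_nonneg {a : Pos (ValueGroup T)} (ha : vpos a = 0) :
    0 ≤ val (shiftLog T a) := by
  have : shiftLog T a = unitLog a := logOfSection_of_vpos_eq_zero _ ha
  rw [this]
  exact val_unitLog_nonneg a

/-- Every infinite element in the image of the logarithm has order `-1_δ` for some `δ`, so the
monomial `t ^ (-2 · 1_γ)` is not in the image. -/
theorem not_surjective_shiftLog [Nonempty T] : ¬ Function.Surjective (shiftLog T).toFun := by
  intro hs
  obtain ⟨t⟩ := ‹Nonempty T›
  set γ : T ×ₗ ℤ := toLex (t, 0)
  set g : ValueGroup T := negUnit γ + negUnit γ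
  have hg0 : g < 0 := add_neg (negUnit_neg γ) (negUnit_neg γ)
  obtain ⟨a, ha⟩ := hs (monomial g).1
  have hval : val (shiftLog T a) = g := (congrArg val ha).trans (val_monomial g)
  have hv : vpos a ≠ 0 := fun hv => by
    have := val_shiftLog_nonneg hv
    rw [hval] at this
    exact hg0.not_ge (by exact_mod_cast this)
  rw [val_shiftLog hv, WithTop.coe_inj] at hval
  set δ := shift T (classIso T (FiniteArchimedeanClass.mk (vpos a) hv))
  have hl := congrArg (fun x : ValueGroup T => (ofLex x).leadingCoeff) hval
  have h1 : (ofLex (negUnit δ)).leadingCoeff = -1 := by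
    change (-single δ (1 : ℝ)).leadingCoeff = -1
    rw [leadingCoeff_neg, leadingCoeff_of_single]
  have h2 : (ofLex g).leadingCoeff = -1 + -1 := by
    change (-single γ (1 : ℝ) + -single γ (1 : ℝ)).leadingCoeff = -1 + -1
    rw [← single_neg, ← single_add, leadingCoeff_of_single]
  simp only [h1, h2] at hl
  norm_num at hl

/-- Under the identification of the archimedean classes with `T ×ₗ ℤ`, the map induced by the
logarithm is the shift. -/
theorem classIso_zeta (α : FiniteArchimedeanClass (ValueGroup T)) :
    classIso T ((shiftLog T).zeta α) = shift T (classIso T α) := by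
  obtain ⟨a, ha, hα⟩ := StrongLog.exists_rep α
  have hv := (notMem_valRing_iff.1 ha).ne
  obtain rfl : FiniteArchimedeanClass.mk (vpos a) hv = α := Subtype.ext hα
  rw [StrongLog.zeta_apply _ a ha]
  have h : (((shiftLog T).vlog a ha : ValueGroup T) : WithTop (ValueGroup T)) =
      val (shiftLog T a) := coe_vpos _
  rw [val_shiftLog hv, WithTop.coe_inj] at h
  rw [classIso_mk_eq_iff, h, orderTop_negUnit]

/-! ### The principal exponential rank -/

theorem unitCompat_shiftLog_iff {W : ValuationSubring (PS (ValueGroup T))} :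
    UnitCompat (shiftLog T) W ↔ ∀ a, a ∈ posUnits W ↔ shiftLog T a ∈ W :=
  image_eq_inter_range_iff (shiftLog T).isLogarithm.strictMono.injective

/-- The convex subgroup of a final segment of `T` is stable under `ζ` and its inverse, since the
shift preserves first coordinates. -/
theorem unitCompat_overring (t : T) :
    UnitCompat (shiftLog T) (overring (convexSubgroup t)) := by
  refine unitCompat_shiftLog_iff.2 fun a => ?_
  rw [mem_posUnits_overring]
  by_cases hv : vpos a = 0
  · rw [hv]
    exact iff_of_true (zero_mem _) (valRing_le_overring _ (val_shiftLog_nonneg hv))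
  · rw [mem_overring_convexSubgroup (val_shiftLog hv) (negUnit_neg (T := T) _).le,
      negUnit_mem_convexSubgroup, fst_shift, mem_convexSubgroup hv]

theorem monomial_negUnit_mem_overring {t : T} {γ : T ×ₗ ℤ} :
    (monomial (negUnit γ)).1 ∈ overring (convexSubgroup t) ↔ t ≤ (ofLex γ).1 := by
  rw [mem_overring_convexSubgroup (val_monomial (negUnit γ)) (negUnit_neg γ).le,
    negUnit_mem_convexSubgroup]

theorem overring_mem_principalExpRank (t : T) :
    overring (convexSubgroup t) ∈ (shiftLog T).principalExpRank := by
  have hmem : (monomial (negUnit (toLex (t, (0 : ℤ))))).1 ∈ overring (convexSubgroup t) :=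
    monomial_negUnit_mem_overring.2 le_rfl
  have hnot : (monomial (negUnit (toLex (t, (0 : ℤ))))).1 ∉ valRing (ValueGroup T) := by
    rw [notMem_valRing_iff, vpos_monomial]
    exact negUnit_neg (T := T) _
  refine ⟨⟨lt_of_le_not_ge (valRing_le_overring _) fun hle => hnot (hle hmem),
    unitCompat_overring t⟩, (shiftQuotIso (classIso T) classIso_zeta).symm t, ?_, ?_⟩
  · refine ⟨monomial (negUnit (toLex (t, (0 : ℤ)))), ?_, fun h => hnot h.1, ?_⟩
    · rw [mem_posUnits_overring, vpos_monomial, negUnit_mem_convexSubgroup, ofLex_toLex]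
    · rw [OrderIso.symm_apply_eq, shiftQuotIso_mk]
      simp only [vpos_monomial, classIso_negUnit, ofLex_toLex]
  · rintro _ ⟨a, ha, ha', rfl⟩
    rw [OrderIso.symm_apply_le, shiftQuotIso_mk]
    exact (mem_convexSubgroup _).1 (mem_posUnits_overring.1 ha)

/-- If `R_w` is in the exponential rank, the set of `γ` with `t ^ (-1_γ) ∈ R_w` is closed under
the inverse of the shift. -/
theorem monomial_negUnit_mem_of_shift {W : ValuationSubring (PS (ValueGroup T))}
    (hW : W ∈ (shiftLog T).expRank) {γ : T ×ₗ ℤ}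
    (h : (monomial (negUnit (shift T γ))).1 ∈ W) : (monomial (negUnit γ)).1 ∈ W := by
  refine ((unitCompat_shiftLog_iff.1 hW.2 (monomial (negUnit γ))).2 ?_).1
  have hv : vpos (monomial (negUnit γ)) ≠ 0 := by
    rw [vpos_monomial]
    exact (negUnit_neg γ).ne
  refine mem_of_val_le hW.1.le h ?_
  rw [val_shiftLog hv, val_monomial]
  simp only [vpos_monomial, classIso_negUnit, le_rfl]

/-- If the least element of `ε(R_w)` is the class of `v_G (v a)`, then `R_w` is the valuation
ring belonging to the final segment `{s | t ≤ s}` of `T`, where `t` is the first coordinate of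
`v_G (v a)` in `T ×ₗ ℤ`. -/
theorem eq_overring_of_mem_principalExpRank {W : ValuationSubring (PS (ValueGroup T))}
    (hW : W ∈ (shiftLog T).principalExpRank) :
    ∃ t : T, overring (convexSubgroup t) = W := by
  obtain ⟨hR, q, ⟨a, ha, ha', rfl⟩, hq⟩ := hW
  have hle := hR.1.le
  have hv : vpos a ≠ 0 := fun h => ha' (mem_posUnits_valRing.2 h)
  set γ := classIso T (FiniteArchimedeanClass.mk (vpos a) hv)
  refine ⟨(ofLex γ).1, le_antisymm ?_ ?_⟩
  · -- One of `a`, `a⁻¹` is infinite, and both lie in `W`.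
    have h0 : (monomial (negUnit γ)).1 ∈ W := by
      have hcls : ArchimedeanClass.mk (vpos a) ≤ ArchimedeanClass.mk (negUnit γ) := by
        rw [mk_le_mk_iff_classIso hv (negUnit_neg γ).ne, classIso_negUnit]
      rcases le_total (vpos a) 0 with h | h
      · exact mem_of_mk_val_le hle ha.1 (coe_vpos a).symm h (val_monomial _) hcls
      · refine mem_of_mk_val_le hle ha.2 (coe_vpos a⁻¹).symm ?_ (val_monomial _) ?_
        · rw [vpos_inv]
          exact neg_nonpos.2 h
        · rwa [vpos_inv, ArchimedeanClass.mk_neg]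
    -- Shifting back from `γ` reaches arbitrarily small elements of the fibre over its first
    -- coordinate.
    have hn : ∀ n : ℕ,
        (monomial (negUnit (toLex ((ofLex γ).1, (ofLex γ).2 - (n : ℤ))))).1 ∈ W := by
      intro n
      induction n with
      | zero => simpa using h0
      | succ n ih =>
        refine monomial_negUnit_mem_of_shift hR ?_
        have : shift T (toLex ((ofLex γ).1, (ofLex γ).2 - ((n + 1 : ℕ) : ℤ))) =
            toLex ((ofLex γ).1, (ofLex γ).2 - (n : ℤ)) := by
          simp [shift, sub_add_eq_sub_sub]
        rwa [this]
    rintro x ⟨g, hg, hx⟩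
    rcases le_or_gt 0 g with hg0 | hg0
    · refine hle (mem_valRing.2 (le_trans ?_ hx))
      exact_mod_cast hg0
    · refine mem_of_val_le hle ?_ ((val_monomial g).trans_le hx)
      set δ := classIso T (FiniteArchimedeanClass.mk g hg0.ne)
      have hδ : (ofLex γ).1 ≤ (ofLex δ).1 := (mem_convexSubgroup hg0.ne).1 hg
      refine mem_of_mk_val_le hle (hn ((ofLex γ).2 - (ofLex δ).2).toNat) (val_monomial _)
        (negUnit_neg (T := T) _).le (val_monomial g) ?_
      rw [mk_le_mk_iff_classIso (negUnit_neg (T := T) _).ne hg0.ne, classIso_negUnit,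
        Prod.Lex.le_iff]
      rcases hδ.lt_or_eq with h | h
      · exact Or.inl h
      · refine Or.inr ⟨h, ?_⟩
        have := Int.self_le_toNat ((ofLex γ).2 - (ofLex δ).2)
        change (ofLex γ).2 - (((ofLex γ).2 - (ofLex δ).2).toNat : ℤ) ≤ (ofLex δ).2
        omega
  · intro x hx
    rcases le_or_gt 0 (val x) with h0 | h0
    · exact valRing_le_overring _ (mem_valRing.2 h0)
    · obtain ⟨g, hg⟩ := WithTop.ne_top_iff_exists.1 h0.ne_top
      rw [← hg] at h0
      have hg0 : g < 0 := by exact_mod_cast h0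
      refine (mem_overring_convexSubgroup hg.symm hg0.le).2 ((mem_convexSubgroup hg0.ne).2 ?_)
      have hm : (monomial g).1 ∈ W := mem_of_val_le hle hx (by rw [val_monomial, hg])
      have hu : monomial g ∈ posUnits W := mem_posUnits_of_mem hle hm (by
        rw [vpos_monomial]
        exact hg0.le)
      have hnu : monomial g ∉ posUnits (valRing (ValueGroup T)) := fun h => by
        rw [mem_posUnits_valRing, vpos_monomial] at h
        exact hg0.ne h
      have hmin := hq ⟨monomial g, hu, hnu, rfl⟩
      rw [← (shiftQuotIso (classIso T) classIso_zeta).le_iff_le, shiftQuotIso_mk,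
        shiftQuotIso_mk] at hmin
      simpa only [vpos_monomial] using hmin

theorem overring_lt_overring {s t : T} (h : t < s) :
    overring (convexSubgroup s) < overring (convexSubgroup t) := by
  refine lt_of_le_not_ge ?_ fun hle => ?_
  · rintro x ⟨g, hg, hx⟩
    exact ⟨g, fun γ hγ => hg γ (hγ.trans h), hx⟩
  · have := hle (monomial_negUnit_mem_overring (γ := toLex (t, 0)).2 le_rfl)
    exact h.not_ge (monomial_negUnit_mem_overring.1 this)

variable (T) in
/-- The valuation rings of the principal final segments of `T` form the principal exponential
rank. -/
def principalExpRankIso : (shiftLog T).principalExpRank ≃o Tᵒᵈ :=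
  (StrictMono.orderIsoOfSurjective
    (fun t : Tᵒᵈ => (⟨overring (convexSubgroup (OrderDual.ofDual t)),
      overring_mem_principalExpRank _⟩ : (shiftLog T).principalExpRank))
    (fun _ _ h => overring_lt_overring (OrderDual.ofDual_lt_ofDual.2 h))
    (fun ⟨_, hW⟩ => (eq_overring_of_mem_principalExpRank hW).imp fun _ ht =>
      Subtype.ext ht)).symm

end ValueGroup

end ExpRank

end

theorem theorem20 (T : Type u) [LinearOrder T] :
    ∃ (G : Type u) (_ : AddCommGroup G) (_ : LinearOrder G) (_ : IsOrderedAddMonoid G),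
      (∀ n : ℕ, n ≠ 0 → ∀ g : G, ∃ g' : G, n • g' = g) ∧
      (∃ ζ : FiniteArchimedeanClass G ≃o FiniteArchimedeanClass G,
        (∀ α, α < ζ α) ∧
        Nonempty (ExpRank.PhiQuot (ζ : FiniteArchimedeanClass G →o FiniteArchimedeanClass G) ≃o T)) ∧
      ∃ h : G →+ ExpRank.PS G, ExpRank.IsStrongCrossSection h ∧
        ∃ ℓ : ExpRank.StrongLog G, ExpRank.GivesRise h ℓ ∧
          (Nonempty T → ¬ Function.Surjective ℓ.toFun) ∧
          Nonempty (ℓ.principalExpRank ≃o Tᵒᵈ) := by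
  let e := ExpRank.classIso T
  refine ⟨ExpRank.ValueGroup T, inferInstance, inferInstance, inferInstance,
    fun n hn g => ExpRank.exists_nsmul_eq hn g,
    ⟨(e.trans (ExpRank.shift T)).trans e.symm, fun α => ?_,
      ⟨ExpRank.shiftQuotIso e fun α => e.apply_symm_apply _⟩⟩,
    ExpRank.crossSection T, ExpRank.isStrongCrossSection_crossSection T,
    ExpRank.shiftLog T, ExpRank.givesRise_strongLogOfSection _ _,
    fun _ => ExpRank.not_surjective_shiftLog, ⟨ExpRank.principalExpRankIso T⟩⟩
  rw [← e.lt_iff_lt]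
  exact (ExpRank.lt_shift (e α)).trans_eq (e.apply_symm_apply _).symm
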